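/- For $x\in\mathbb R$ let $\langle x\rangle=\lceil x-\tfrac12\rceil$ be the nearest integer, with $\langle n+\tfrac12\rangle=n$ for $n\in\mathbb Z$, and for $\mu\in\mathbb C$ let $\{\mu\}=\mu-\langle\operatorname{Re}\mu\rangle$, so that $-\tfrac12<\operatorname{Re}\{\mu\}\le\tfrac12$. Let $$J_\mu(z)=\Big(\frac z2\Big)^{\mu}\sum_{k=0}^\infty\frac{(-1)^k(z/2)^{2k}}{k!\,\Gamma(\mu+k+1)}$$ be the Bessel function of the first kind, with principal powers and $1/\Gamma=0$ at the poles of $\Gamma$ (for $\mu\in\mathbb Z$ it is entire in $z$, and $J_{-n}(0)=0$ for $n\ge1$). Let $P(a,w)=\gamma(a,w)/\Gamma(a)=w^a\gamma^*(a,w)$ be the regularized lower incomplete gamma function (continued analytically in $a$), where $\gamma^*$ is the entire function with $\gamma^*(a,w)=\frac1{\Gamma(a)}\sum_{m\ge0}\frac{(-w)^m}{(a+m)\,m!}$ for $a\ne0,-1,-2,\dots$ and $\gamma^*(-n,w)=w^n$ for $n=0,1,2,\dots$; in particular $P(0,w)=1$. Let $\mu\in\mathbb C$, and let $z\in\mathbb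 C\setminus(-\infty,0]$, or $z\in\mathbb C$ arbitrary if $\mu\in\mathbb Z$. Then $$J_\mu(z)=\frac{i^\mu}{\pi}\int_0^\pi e^{-iz\cos\theta}\,P\big(\{\mu\},-iz(1+\cos\theta)\big)\cos\mu\theta\,d\theta+\frac{i^\mu}{\sqrt\pi}\,e^{iz}\sum_{j=1}^{-\langle\operatorname{Re}\mu\rangle}\frac{\Gamma(j+\mu-\frac12)}{\Gamma(j)\,\Gamma(j+2\mu)}\,(-2iz)^{j+\mu-1},$$ where the integral converges absolutely. Here $i^\mu=e^{i\pi\mu/2}$, and non-integer powers of $-iz(1+\cos\theta)$ and of $-2iz$ are taken with the argument $\arg z-\frac\pi2$, $-\pi<\arg z<\pi$, so that they are holomorphic in $z$ on $\mathbb C\setminus(-\infty,0]$. The quotient of gamma functions is understood as its (existing, finite) limit in $\mu$ where its numerator has a pole, and as zero where only its denominator has one; in particular every term of the sum vanishes for $\mu\in\mathbb Z$ (also at $z=0$). The sum is empty, hence zero, exactly when $\langle\operatorname{Re}\mu\rangle\ge0$, that is, when $\operatorname{Re}\mu>-\frac12$. -/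

import Mathlib

open scoped Topology

noncomputable section

/-- The nearest integer to a real number, half-integers being rounded down:
`nearestInt (n + 1/2) = n` for every integer `n`. -/
def nearestInt (x : ℝ) : ℤ := ⌈x - 1 / 2⌉

/-- The (complex) fractional part of a complex number; its real part lies in `(-1/2, 1/2]`. -/
def fracPart (μ : ℂ) : ℂ := μ - (nearestInt μ.re : ℂ)

/-- The Bessel function of the first kind `J_μ(z)`, with the principal branch of `(z/2)^μ`.
The terms in which `μ + k + 1` is a pole of `Γ` are zero (there Mathlib's `Complex.Gamma`
has the value `0`, and so has its inverse, in agreement with the entire function `1/Γ`). -/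
def besselJ (μ z : ℂ) : ℂ :=
  (z / 2) ^ μ *
    ∑' k : ℕ, (-1) ^ k * (z / 2) ^ (2 * k) / ((k.factorial : ℂ) * Complex.Gamma (μ + k + 1))

/-- The branch of the power `w ^ s` with `-3π/2 < arg w ≤ π/2`: it is cut along the positive
imaginary axis and coincides with the principal branch for `Re w > 0`. If `w = -i z t` with
`t > 0` and `z` off the cut `(-∞, 0]`, it takes `arg w = arg z - π/2` with the principal
`arg z`, so that it is holomorphic in `z` on `ℂ ∖ (-∞, 0]`. -/
def rotPow (w s : ℂ) : ℂ :=
  Complex.exp (-(Real.pi / 2 * s * Complex.I)) * (Complex.I * w) ^ s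

open Classical in
/-- The entire incomplete gamma function `γ*(a, w)`, equal to `w ^ (-a) γ(a, w) / Γ(a)`. -/
def gammaStar (a w : ℂ) : ℂ :=
  if h : ∃ n : ℕ, a = -(n : ℂ) then w ^ h.choose
  else (Complex.Gamma a)⁻¹ * ∑' m : ℕ, (-w) ^ m / ((a + m) * (m.factorial : ℂ))

/-- The regularized lower incomplete gamma function `P(a, w) = γ(a, w) / Γ(a)`, continued
analytically in `a`, with the branch `rotPow` of `w ^ a`. -/
def regGammaP (a w : ℂ) : ℂ := rotPow w a * gammaStar a w

/-- The quotient `Γ(j + μ - 1/2) / (Γ(j) Γ(j + 2μ))`. -/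
def gammaQuot (j : ℤ) (μ : ℂ) : ℂ :=
  Complex.Gamma (j + μ - 1 / 2) / (Complex.Gamma j * Complex.Gamma (j + 2 * μ))

open Classical in
/-- The quotient `Γ(j + μ - 1/2) / (Γ(j) Γ(j + 2μ))`, understood as its limit in `μ` where the
numerator has a pole. -/
def sumCoeff (j : ℤ) (μ : ℂ) : ℂ :=
  if ∃ k : ℕ, (j : ℂ) + μ - 1 / 2 = -(k : ℂ) then
    Filter.limUnder (𝓝[≠] μ) (fun s : ℂ => gammaQuot j s)
  else gammaQuot j μ

/-- The integrand `e^{-i z cos θ} P({μ}, -i z (1 + cos θ)) cos μθ`. -/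
def repIntegrand (μ z : ℂ) (θ : ℝ) : ℂ :=
  Complex.exp (-(Complex.I * z * Real.cos θ)) *
    regGammaP (fracPart μ) (-(Complex.I * z * (1 + Real.cos θ))) * Complex.cos (μ * θ)

end

/-! Both sides equal `e^{iz} (z/2)^μ ∑ₖ cₖ (-iz/2)^k` with `cₖ = binom(2μ+2k, k) / Γ(μ+k+1)`
(`kummerCoeff`). For `J_μ` this is Kummer's second transformation (`besselJ_eq_kummer`).

In the integral, put `a = {μ}`, `N = ⟨Re μ⟩` and expand `P(a, w) = w^a e^{-w} ∑ₘ w^m / Γ(a+m+1)`.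
The exponentials multiply to the constant `e^{iz}`, and what remains are the integrals of `(1 + cos
θ)^{a+m} cos μθ`. Cauchy's formula `∫₀^π (1 + cos θ)^s cos((s-k)θ) dθ = π 2^{-s} binom(2s, k)`, with
`s = a + m` and `k = m - N`, evaluates them. Negative `k` contribute zero, so the integral yields
exactly the Kummer terms with `k ≥ max(0, -N)` (`representation_term`).

If `N < 0`, the terms `0 ≤ k < -N` are missing. By Legendre duplication they are the finite sum,
with `j = k + 1` (`extra_term`). -/

noncomputable section

/-! ### Binomial and Kummer coefficients -/

/-- The generalized binomial coefficient `p (p - 1) ⋯ (p - k + 1) / k!`. -/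
def genBinom (p : ℂ) (k : ℕ) : ℂ := (∏ i ∈ Finset.range k, (p - i)) / (k.factorial : ℂ)

lemma genBinom_zero_right (p : ℂ) : genBinom p 0 = 1 := by simp [genBinom]

lemma genBinom_succ (p : ℂ) (k : ℕ) :
    ((k : ℂ) + 1) * genBinom p (k + 1) = (p - k) * genBinom p k := by
  have h : (k.factorial : ℂ) ≠ 0 := by exact_mod_cast k.factorial_ne_zero
  have h' : (k : ℂ) + 1 ≠ 0 := by exact_mod_cast k.succ_ne_zero
  simp only [genBinom, Finset.prod_range_succ, Nat.factorial_succ, Nat.cast_mul, Nat.cast_add,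
    Nat.cast_one]
  field_simp

lemma prod_sub_add_two (p : ℂ) (k : ℕ) :
    ∏ i ∈ Finset.range (k + 2), (p - i) = p * (p - 1) * ∏ i ∈ Finset.range k, (p - 2 - i) := by
  rw [Finset.prod_range_succ', Finset.prod_range_succ']
  have : ∀ i : ℕ, p - ((i + 1 + 1 : ℕ) : ℂ) = p - 2 - i := fun i => by push_cast; ring
  simp only [this]
  push_cast
  ring

/-- Appending the factor `x + k + 1` to the `k + 1` factors on the left gives a falling product of
length `k + 2`; removing its two largest factors leaves the product on the right. -/
lemma genBinom_diag_succ (x : ℂ) (k : ℕ) :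
    (x + k + 1) * ((k : ℂ) + 1) * genBinom (x + 2 * (k + 1 : ℕ)) (k + 1) =
      (x + 2 * k + 1) * (x + 2 * k + 2) * genBinom (x + 2 * k) k := by
  have h : (k.factorial : ℂ) ≠ 0 := by exact_mod_cast k.factorial_ne_zero
  have h' : (k : ℂ) + 1 ≠ 0 := by exact_mod_cast k.succ_ne_zero
  have h1 := prod_sub_add_two (x + 2 * (k + 1 : ℕ)) k
  rw [Finset.prod_range_succ] at h1
  have e1 : x + 2 * ((k + 1 : ℕ) : ℂ) - 2 = x + 2 * k := by push_cast; ring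
  have e2 : x + 2 * ((k + 1 : ℕ) : ℂ) - ((k + 1 : ℕ) : ℂ) = x + k + 1 := by push_cast; ring
  have e3 : x + 2 * ((k + 1 : ℕ) : ℂ) - 1 = x + 2 * k + 1 := by push_cast; ring
  rw [e1, e2, e3] at h1
  simp only [genBinom, Nat.factorial_succ, Nat.cast_mul]
  generalize ∏ i ∈ Finset.range (k + 1), (x + 2 * ((k + 1 : ℕ) : ℂ) - i) = A at h1 ⊢
  generalize ∏ i ∈ Finset.range k, (x + 2 * (k : ℂ) - i) = B at h1 ⊢
  push_cast at h1 ⊢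
  field_simp
  linear_combination h1

lemma Gamma_add_one_eq_prod_mul (y : ℂ) (n : ℕ) (h : ∀ i < n, y - i ≠ 0) :
    Complex.Gamma (y + 1) = (∏ i ∈ Finset.range n, (y - i)) * Complex.Gamma (y + 1 - n) := by
  induction n with
  | zero => simp
  | succ n ih =>
    rw [ih fun i hi => h i (hi.trans n.lt_succ_self), Finset.prod_range_succ,
      show y + 1 - (n : ℂ) = (y - n) + 1 by ring, Complex.Gamma_add_one _ (h n n.lt_succ_self)]
    push_cast
    rw [show y + 1 - ((n : ℂ) + 1) = y - n by ring]
    ring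

/-- Taylor coefficients of the regularized Kummer function attached to `J_μ`. -/
def kummerCoeff (μ : ℂ) (k : ℕ) : ℂ :=
  genBinom (2 * μ + 2 * k) k * (Complex.Gamma (μ + k + 1))⁻¹

lemma kummerCoeff_succ (μ : ℂ) (k : ℕ) :
    ((k : ℂ) + 1) * (2 * μ + k + 1) * kummerCoeff μ (k + 1) =
      2 * (2 * μ + 2 * k + 1) * kummerCoeff μ k := by
  have h1 := genBinom_diag_succ (2 * μ) k
  have h2 := Complex.one_div_Gamma_eq_self_mul_one_div_Gamma_add_one (μ + k + 1)
  rw [kummerCoeff, kummerCoeff, h2,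
    show μ + ((k + 1 : ℕ) : ℂ) + 1 = μ + k + 1 + 1 by push_cast; ring]
  linear_combination (Complex.Gamma (μ + k + 1 + 1))⁻¹ * h1

lemma continuous_genBinom {f : ℂ → ℂ} (hf : Continuous f) (k : ℕ) :
    Continuous fun s => genBinom (f s) k := by
  unfold genBinom
  fun_prop

lemma continuous_inv_Gamma_comp {f : ℂ → ℂ} (hf : Continuous f) :
    Continuous fun s => (Complex.Gamma (f s))⁻¹ :=
  Complex.differentiable_one_div_Gamma.continuous.comp hf

lemma continuous_kummerCoeff (k : ℕ) : Continuous fun μ => kummerCoeff μ k :=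
  (continuous_genBinom (by fun_prop) k).mul (continuous_inv_Gamma_comp (by fun_prop))

/-! ### Extension to exceptional `μ` by continuity -/

/-- All integers are excluded at once: `2s ∈ ℤ` forces `exp(4πis) = 1`, and this exponential has
nonzero derivative, so it takes the value `1` at isolated points only. -/
lemma eventually_two_mul_ne_int (μ : ℂ) : ∀ᶠ s in 𝓝[≠] μ, ∀ n : ℤ, 2 * s ≠ (n : ℂ) := by
  have h : HasDerivAt (fun s : ℂ => Complex.exp (4 * Real.pi * Complex.I * s))
      (Complex.exp (4 * Real.pi * Complex.I * μ) * (4 * Real.pi * Complex.I)) μ := by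
    simpa using ((hasDerivAt_id μ).const_mul (4 * Real.pi * Complex.I : ℂ)).cexp
  have h0 : Complex.exp (4 * Real.pi * Complex.I * μ) * (4 * Real.pi * Complex.I) ≠ 0 := by
    simp [Real.pi_ne_zero]
  filter_upwards [h.eventually_ne (c := 1) h0] with s hs n hn
  refine hs (Complex.exp_eq_one_iff.2 ⟨n, ?_⟩)
  rw [← hn]
  ring

lemma eq_of_continuous_of_eq_off_half_int {f g : ℂ → ℂ} (hf : Continuous f) (hg : Continuous g)
    (h : ∀ s : ℂ, (∀ n : ℤ, 2 * s ≠ n) → f s = g s) (μ : ℂ) : f μ = g μ := by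
  have h1 : Filter.Tendsto f (𝓝[≠] μ) (𝓝 (f μ)) := hf.continuousAt.mono_left nhdsWithin_le_nhds
  have h2 : Filter.Tendsto g (𝓝[≠] μ) (𝓝 (g μ)) := hg.continuousAt.mono_left nhdsWithin_le_nhds
  exact tendsto_nhds_unique_of_eventuallyEq h1 h2
    ((eventually_two_mul_ne_int μ).mono fun s hs => h s hs)

/-! ### Kummer's second transformation -/

/-- The exponential power series `e^{cX}`. -/
def expSeries (c : ℂ) : PowerSeries ℂ := PowerSeries.mk fun n => c ^ n / (n.factorial : ℂ)

lemma derivative_expSeries (c : ℂ) :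
    PowerSeries.derivative ℂ (expSeries c) = PowerSeries.C c * expSeries c := by
  ext n
  have h : (n.factorial : ℂ) ≠ 0 := by exact_mod_cast n.factorial_ne_zero
  have h' : (n : ℂ) + 1 ≠ 0 := by exact_mod_cast n.succ_ne_zero
  simp only [PowerSeries.coeff_derivative, PowerSeries.coeff_C_mul, expSeries,
    PowerSeries.coeff_mk, Nat.factorial_succ]
  push_cast
  field_simp
  ring

/-- The power series with coefficients `(-1)^k kummerCoeff μ k`. -/
def kummerSeries (μ : ℂ) : PowerSeries ℂ := PowerSeries.mk fun k => (-1) ^ k * kummerCoeff μ k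

open PowerSeries in
lemma kummerSeries_ode (μ : ℂ) :
    X * derivative ℂ (derivative ℂ (kummerSeries μ)) + C (2 * μ + 1) * derivative ℂ (kummerSeries μ)
      = -(C 4 * X * derivative ℂ (kummerSeries μ)) - C (2 * (2 * μ + 1)) * kummerSeries μ := by
  have h := kummerCoeff_succ μ
  -- An opaque `b` prevents `map_add` from splitting `C (2 * μ + 1)`.
  generalize hb : 2 * μ + 1 = b
  ext n
  rcases n with _ | n
  · have h := h 0
    simp only [mul_assoc, map_add, map_sub, map_neg, coeff_C_mul, coeff_zero_X_mul,
      coeff_derivative, coeff_derivative, kummerSeries, coeff_mk]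
    push_cast at h ⊢
    subst hb
    linear_combination -h
  · have h := h (n + 1)
    simp only [mul_assoc, map_add, map_sub, map_neg, coeff_C_mul, coeff_succ_X_mul,
      coeff_derivative, kummerSeries, coeff_mk]
    push_cast at h ⊢
    subst hb
    linear_combination (-1) ^ n * h

-- The factor `e^{2X}` removes the terms `X K'` and `K` from the equation. What is left links only
-- coefficients two apart, as for the Bessel series.
open PowerSeries in
lemma exp_mul_kummerSeries_ode (μ : ℂ) :
    X * derivative ℂ (derivative ℂ (expSeries 2 * kummerSeries μ)) +
      C (2 * μ + 1) * derivative ℂ (expSeries 2 * kummerSeries μ)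
      = C 4 * X * (expSeries 2 * kummerSeries μ) := by
  have h := kummerSeries_ode μ
  have e4 : (C (4 : ℂ) : PowerSeries ℂ) = C 2 * C 2 := by rw [← map_mul]; norm_num
  have e5 : (C (2 * (2 * μ + 1)) : PowerSeries ℂ) = C 2 * C (2 * μ + 1) := by rw [← map_mul]
  have e6 : (C (2 : ℂ) : PowerSeries ℂ) = 2 := map_ofNat C 2
  have hC : derivative ℂ (C (2:ℂ)) = 0 := derivative_C
  rw [e5, e4] at h
  rw [e4]
  generalize C (2 * μ + 1) = B at h ⊢
  simp only [Derivation.leibniz, smul_eq_mul, map_add, derivative_expSeries, hC]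
  -- The two equal Leibniz cross terms produce a numeral `2`, which `e6` identifies with `C 2`.
  linear_combination expSeries 2 * h -
    X * expSeries 2 * derivative ℂ (kummerSeries μ) * C 2 * e6

/-- Coefficients of `∑ u^{2k} / (k! Γ(μ + k + 1))`. -/
def besselCoeff (μ : ℂ) (n : ℕ) : ℂ :=
  if Even n then (((n / 2).factorial : ℂ))⁻¹ * (Complex.Gamma (μ + (n / 2 : ℕ) + 1))⁻¹ else 0

lemma besselCoeff_add_two (μ : ℂ) (n : ℕ) :
    ((n : ℂ) + 2) * (2 * μ + n + 2) * besselCoeff μ (n + 2) = 4 * besselCoeff μ n := by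
  unfold besselCoeff
  rcases Nat.even_or_odd n with h | h
  · rw [if_pos (h.add (by decide)), if_pos h]
    obtain ⟨m, rfl⟩ := h
    have h2 := Complex.one_div_Gamma_eq_self_mul_one_div_Gamma_add_one (μ + m + 1)
    rw [show (m + m + 2) / 2 = m + 1 by omega, show (m + m) / 2 = m by omega, h2,
      Nat.factorial_succ, show μ + ((m + 1 : ℕ) : ℂ) + 1 = μ + m + 1 + 1 by push_cast; ring]
    have h : (m.factorial : ℂ) ≠ 0 := by exact_mod_cast m.factorial_ne_zero
    have h' : (m : ℂ) + 1 ≠ 0 := by exact_mod_cast m.succ_ne_zero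
    push_cast
    field_simp
    ring
  · rw [if_neg (by simpa [Nat.even_add] using h), if_neg (by simpa using h)]
    simp

lemma continuous_besselCoeff (n : ℕ) : Continuous fun μ => besselCoeff μ n := by
  unfold besselCoeff
  split_ifs
  · exact continuous_const.mul (continuous_inv_Gamma_comp (by fun_prop))
  · exact continuous_const

-- As no `2μ + k` vanishes, the differential equation determines every coefficient from the constant
-- one, and `besselCoeff` obeys the same recurrence.
open PowerSeries in
lemma coeff_exp_mul_kummerSeries_of_generic (μ : ℂ) (hμ : ∀ n : ℤ, 2 * μ ≠ n) (n : ℕ) :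
    coeff n (expSeries 2 * kummerSeries μ) = besselCoeff μ n := by
  have hne : ∀ k : ℕ, 2 * μ + k ≠ 0 := fun k hk => hμ (-k) (by push_cast; linear_combination hk)
  set F := expSeries 2 * kummerSeries μ with hF
  have hode : X * derivative ℂ (derivative ℂ F) + C (2 * μ + 1) * derivative ℂ F = C 4 * X * F :=
    exp_mul_kummerSeries_ode μ
  generalize hb : 2 * μ + 1 = b at hode
  induction n using Nat.strong_induction_on with
  | _ n ih =>
    match n with
    | 0 =>
      simp [hF, expSeries, kummerSeries, kummerCoeff, besselCoeff, genBinom]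
    | 1 =>
      have h := congrArg (coeff 0) hode
      simp only [mul_assoc, map_add, coeff_C_mul, coeff_zero_X_mul, coeff_derivative] at h
      have h1 := hne 1
      push_cast at h h1
      have : (2 * μ + 1) * coeff 1 F = 0 := by linear_combination h + coeff 1 F * hb
      rw [(mul_eq_zero.1 this).resolve_left h1]
      simp [besselCoeff]
    | n + 2 =>
      have h := congrArg (coeff (n + 1)) hode
      simp only [mul_assoc, map_add, coeff_C_mul, coeff_succ_X_mul, coeff_derivative] at h
      rw [ih n (by omega)] at h
      have h1 : (n : ℂ) + 2 ≠ 0 := by exact_mod_cast (n + 1).succ_ne_zero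
      have h2 := hne (n + 2)
      push_cast at h h2
      refine mul_left_cancel₀ (mul_ne_zero h1 h2) ?_
      rw [← add_assoc, besselCoeff_add_two]
      linear_combination h + ((n : ℂ) + 2) * coeff (n + 2) F * hb

open PowerSeries in
lemma coeff_exp_mul_kummerSeries (μ : ℂ) (n : ℕ) :
    coeff n (expSeries 2 * kummerSeries μ) = besselCoeff μ n := by
  refine eq_of_continuous_of_eq_off_half_int (f := fun μ => coeff n (expSeries 2 * kummerSeries μ))
    (g := fun μ => besselCoeff μ n) ?_ (continuous_besselCoeff n)
    (fun s hs => coeff_exp_mul_kummerSeries_of_generic s hs n) μ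
  simp only [coeff_mul, expSeries, kummerSeries, coeff_mk]
  exact continuous_finsetSum _ fun i _ =>
    continuous_const.mul (continuous_const.mul (continuous_kummerCoeff _))

lemma sum_antidiagonal_mul_pow (f g : ℕ → ℂ) (u : ℂ) (n : ℕ) :
    ∑ kl ∈ Finset.HasAntidiagonal.antidiagonal n, f kl.1 * u ^ kl.1 * (g kl.2 * u ^ kl.2) =
      PowerSeries.coeff n (PowerSeries.mk f * PowerSeries.mk g) * u ^ n := by
  rw [PowerSeries.coeff_mul, Finset.sum_mul]
  refine Finset.sum_congr rfl fun kl hkl => ?_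
  rw [← Finset.HasAntidiagonal.mem_antidiagonal.1 hkl, pow_add, PowerSeries.coeff_mk, PowerSeries.coeff_mk]
  ring

lemma summable_norm_exp_terms (c u : ℂ) :
    Summable fun n : ℕ => ‖c ^ n / (n.factorial : ℂ) * u ^ n‖ := by
  refine (Real.summable_pow_div_factorial (‖c * u‖)).congr fun n => ?_
  simp only [norm_mul, norm_div, norm_pow, mul_pow, Complex.norm_natCast]
  ring

lemma tsum_exp_terms (c u : ℂ) :
    ∑' n : ℕ, c ^ n / (n.factorial : ℂ) * u ^ n = Complex.exp (c * u) := by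
  rw [Complex.exp_eq_exp_ℂ, NormedSpace.exp_eq_tsum_div]
  refine tsum_congr fun n => ?_
  rw [mul_pow]
  ring

lemma exp_mul_tsum (c u : ℂ) (g : ℕ → ℂ) (hg : Summable fun n => ‖g n * u ^ n‖) :
    Complex.exp (c * u) * ∑' n, g n * u ^ n =
      ∑' n, PowerSeries.coeff n (expSeries c * PowerSeries.mk g) * u ^ n := by
  rw [← tsum_exp_terms, tsum_mul_tsum_eq_tsum_sum_antidiagonal_of_summable_norm
    (summable_norm_exp_terms c u) hg]
  exact tsum_congr fun n => sum_antidiagonal_mul_pow (fun n => c ^ n / (n.factorial : ℂ)) g u n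

lemma summable_norm_kummer (μ u : ℂ) : Summable fun k : ℕ => ‖kummerCoeff μ k * u ^ k‖ := by
  refine summable_of_ratio_norm_eventually_le (r := 1 / 2) (by norm_num) ?_
  -- The part in `μ` bounds the coefficient ratio by `8 / (k + 1)`; the part `16‖u‖` then brings the
  -- ratio of terms below `1/2`.
  obtain ⟨K, hK⟩ := exists_nat_gt (2 * ‖2 * μ‖ + 16 * ‖u‖ + 1)
  filter_upwards [Filter.eventually_ge_atTop K] with k hk
  have hk' : 2 * ‖2 * μ‖ + 16 * ‖u‖ + 1 < k := hK.trans_le (by exact_mod_cast hk)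
  have h := congrArg norm (kummerCoeff_succ μ k)
  rw [norm_norm, norm_norm, norm_mul, norm_mul, pow_succ, norm_mul]
  simp only [norm_mul, RCLike.norm_ofNat] at h
  have n1 : ‖(k : ℂ) + 1‖ = k + 1 := by
    rw [← Nat.cast_one, ← Nat.cast_add, Complex.norm_natCast]; push_cast; ring
  have n2 : ((k : ℝ) + 1) / 2 ≤ ‖2 * μ + k + 1‖ := by
    have := norm_sub_le (2 * μ + k + 1) (2 * μ)
    rw [show 2 * μ + k + 1 - 2 * μ = (k : ℂ) + 1 by ring, n1] at this
    linarith [norm_nonneg u]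
  have n3 : ‖2 * μ + 2 * k + 1‖ ≤ 4 * ‖2 * μ + k + 1‖ := by
    have := norm_sub_le (2 * (2 * μ + k + 1)) (2 * μ + 1)
    rw [show 2 * (2 * μ + k + 1) - (2 * μ + 1) = 2 * μ + 2 * k + 1 by ring, norm_mul] at this
    have h3 := norm_add_le (2 * μ) 1
    simp only [RCLike.norm_ofNat, norm_one] at this h3
    linarith [norm_nonneg u, norm_nonneg (2 * μ)]
  rw [n1] at h
  have hpos : 0 < ‖2 * μ + k + 1‖ := lt_of_lt_of_le (by positivity) n2
  have key : ((k : ℝ) + 1) * ‖kummerCoeff μ (k + 1)‖ ≤ 8 * ‖kummerCoeff μ k‖ := by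
    refine le_of_mul_le_mul_right ?_ hpos
    nlinarith [norm_nonneg (kummerCoeff μ k)]
  have key2 : ‖kummerCoeff μ (k + 1)‖ * ‖u‖ ≤ 1 / 2 * ‖kummerCoeff μ k‖ := by
    have hk1 : (0 : ℝ) < k + 1 := by positivity
    refine le_of_mul_le_mul_left ?_ hk1
    have h16 : 16 * ‖u‖ ≤ k + 1 := by linarith [norm_nonneg (2 * μ)]
    nlinarith [norm_nonneg (kummerCoeff μ k), norm_nonneg u,
      mul_le_mul_of_nonneg_right key (norm_nonneg u),
      mul_le_mul_of_nonneg_left h16 (norm_nonneg (kummerCoeff μ k))]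
  calc ‖kummerCoeff μ (k + 1)‖ * (‖u ^ k‖ * ‖u‖)
      = ‖kummerCoeff μ (k + 1)‖ * ‖u‖ * ‖u ^ k‖ := by ring
    _ ≤ 1 / 2 * ‖kummerCoeff μ k‖ * ‖u ^ k‖ := by gcongr
    _ = _ := by ring

/-- Kummer's second transformation for the Bessel series. -/
lemma tsum_bessel_eq_exp_mul_tsum_kummer (μ u : ℂ) :
    ∑' k : ℕ, u ^ (2 * k) / ((k.factorial : ℂ) * Complex.Gamma (μ + k + 1)) =
      Complex.exp (2 * u) * ∑' k : ℕ, kummerCoeff μ k * (-u) ^ k := by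
  have hs : Summable fun k : ℕ => ‖(-1) ^ k * kummerCoeff μ k * u ^ k‖ :=
    (summable_norm_kummer μ u).congr fun k => by simp
  have h := exp_mul_tsum 2 u (fun k => (-1) ^ k * kummerCoeff μ k) hs
  have e : ∑' k : ℕ, kummerCoeff μ k * (-u) ^ k =
      ∑' k : ℕ, (-1) ^ k * kummerCoeff μ k * u ^ k :=
    tsum_congr fun k => by rw [neg_pow]; ring
  rw [e, h]
  change _ = ∑' n, PowerSeries.coeff n (expSeries 2 * kummerSeries μ) * u ^ n
  simp only [coeff_exp_mul_kummerSeries]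
  have hinj : Function.Injective fun k : ℕ => 2 * k := fun a b hab => by simpa using hab
  rw [← hinj.tsum_eq (f := fun n => besselCoeff μ n * u ^ n)]
  · refine tsum_congr fun k => ?_
    simp only [besselCoeff, even_two_mul, if_true,
      Nat.mul_div_cancel_left k (show 0 < 2 by norm_num)]
    rw [div_eq_mul_inv, mul_inv]
    ring
  · intro n hn
    by_contra hc
    refine hn ?_
    have : ¬ Even n := fun ⟨m, hm⟩ => hc ⟨m, by simp only; omega⟩
    simp [besselCoeff, this]

/-! ### Series for `γ*` -/

lemma inv_Gamma_add_nat (a : ℂ) (m : ℕ) :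
    (Complex.Gamma (a + m + 1))⁻¹ = (a + m + 1) * (Complex.Gamma (a + (m + 1 : ℕ) + 1))⁻¹ := by
  rw [Complex.one_div_Gamma_eq_self_mul_one_div_Gamma_add_one]
  push_cast
  rw [show a + ((m : ℂ) + 1) + 1 = a + m + 1 + 1 by ring]

lemma summable_norm_inv_Gamma_mul_pow (a w : ℂ) :
    Summable fun m : ℕ => ‖(Complex.Gamma (a + m + 1))⁻¹ * w ^ m‖ := by
  refine summable_of_ratio_norm_eventually_le (r := 1 / 2) (by norm_num) ?_
  obtain ⟨K, hK⟩ := exists_nat_gt (‖a‖ + 2 * ‖w‖)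
  filter_upwards [Filter.eventually_ge_atTop K] with k hk
  have hk' : ‖a‖ + 2 * ‖w‖ < k := hK.trans_le (by exact_mod_cast hk)
  have n1 : ‖(k : ℂ) + 1‖ = k + 1 := by
    rw [← Nat.cast_one, ← Nat.cast_add, Complex.norm_natCast]; push_cast; ring
  have n2 : 2 * ‖w‖ ≤ ‖a + k + 1‖ := by
    have := norm_sub_le (a + k + 1) a
    rw [show a + k + 1 - a = (k : ℂ) + 1 by ring, n1] at this
    linarith
  rw [inv_Gamma_add_nat a k, norm_norm, norm_norm, pow_succ]
  simp only [norm_mul]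
  calc ‖(Complex.Gamma (a + (k + 1 : ℕ) + 1))⁻¹‖ * (‖w ^ k‖ * ‖w‖)
      = 1 / 2 * (2 * ‖w‖ * ‖(Complex.Gamma (a + (k + 1 : ℕ) + 1))⁻¹‖ * ‖w ^ k‖) := by ring
    _ ≤ 1 / 2 * (‖a + k + 1‖ * ‖(Complex.Gamma (a + (k + 1 : ℕ) + 1))⁻¹‖ * ‖w ^ k‖) := by gcongr

-- The series `G` of reciprocal gammas satisfies `X G' + a G = 1/Γ(a) + X G`. Multiplication by
-- `e^{-X}` cancels `X G`, and the coefficients can be read off after division by `a + n`.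
open PowerSeries in
lemma coeff_exp_mul_inv_Gamma (a : ℂ) (ha : ∀ n : ℕ, a ≠ -n) (n : ℕ) :
    coeff n (expSeries (-1) * mk fun m : ℕ => (Complex.Gamma (a + m + 1))⁻¹) =
      (Complex.Gamma a)⁻¹ * ((-1) ^ n / ((a + n) * (n.factorial : ℂ))) := by
  set G : PowerSeries ℂ := mk fun m : ℕ => (Complex.Gamma (a + m + 1))⁻¹ with hG
  have hode : X * derivative ℂ G + C a * G = C (Complex.Gamma a)⁻¹ + X * G := by
    ext m
    rcases m with _ | m
    · have h := Complex.one_div_Gamma_eq_self_mul_one_div_Gamma_add_one a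
      simp only [map_add, coeff_C_mul, coeff_zero_X_mul, coeff_C, if_true, hG, coeff_mk, h]
      simp
    · have h := inv_Gamma_add_nat a m
      simp only [map_add, coeff_C_mul, coeff_succ_X_mul, coeff_C, coeff_derivative, hG, coeff_mk]
      rw [if_neg (Nat.succ_ne_zero m), h]
      push_cast
      ring
  have hode' : X * derivative ℂ (expSeries (-1) * G) + C a * (expSeries (-1) * G) =
      C (Complex.Gamma a)⁻¹ * expSeries (-1) := by
    have e : (C (-1 : ℂ) : PowerSeries ℂ) = -1 := by simp
    simp only [Derivation.leibniz, smul_eq_mul, derivative_expSeries, e]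
    linear_combination expSeries (-1) * hode
  have h0 : a + n ≠ 0 := fun h => ha n (by linear_combination h)
  have hn : (n.factorial : ℂ) ≠ 0 := by exact_mod_cast n.factorial_ne_zero
  have h := congrArg (coeff n) hode'
  have key : (a + n) * coeff n (expSeries (-1) * G) =
      (Complex.Gamma a)⁻¹ * ((-1) ^ n / (n.factorial : ℂ)) := by
    have e : coeff n (expSeries (-1)) = (-1) ^ n / (n.factorial : ℂ) := by
      simp [expSeries]
    rcases n with _ | n
    · simp only [map_add, coeff_C_mul, coeff_zero_X_mul, e] at h
      push_cast
      linear_combination h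
    · simp only [map_add, coeff_C_mul, coeff_succ_X_mul, coeff_derivative, e] at h
      push_cast
      linear_combination h
  refine mul_left_cancel₀ h0 ?_
  rw [key]
  field_simp

/-- The expansion of `γ*` into the everywhere convergent series of reciprocal gamma functions. -/
lemma gammaStar_eq_exp_mul_tsum (a w : ℂ) (ha : ∀ n : ℕ, n ≠ 0 → a ≠ -n) :
    gammaStar a w = Complex.exp (-w) * ∑' m : ℕ, (Complex.Gamma (a + m + 1))⁻¹ * w ^ m := by
  by_cases h : ∃ n : ℕ, a = -(n : ℂ)
  · have hc : h.choose = 0 := by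
      by_contra h0
      exact ha _ h0 h.choose_spec
    have ha0 : a = 0 := by rw [h.choose_spec, hc]; simp
    rw [gammaStar, dif_pos h, hc, pow_zero]
    have e : ∀ m : ℕ, (Complex.Gamma (a + m + 1))⁻¹ * w ^ m =
        1 ^ m / (m.factorial : ℂ) * w ^ m := fun m => by
      rw [ha0, zero_add, Complex.Gamma_nat_eq_factorial, one_pow, one_div]
    simp only [e]
    rw [tsum_exp_terms, one_mul, ← Complex.exp_add]
    simp
  · have ha' : ∀ n : ℕ, a ≠ -n := fun n hn => h ⟨n, hn⟩
    rw [gammaStar, dif_neg h, ← neg_one_mul w,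
      exp_mul_tsum (-1) w _ (summable_norm_inv_Gamma_mul_pow a w), ← tsum_mul_left]
    refine tsum_congr fun m => ?_
    rw [coeff_exp_mul_inv_Gamma a ha', mul_pow]
    ring

/-! ### Gamma quotients as Kummer coefficients -/

/-- Duplication at `s + k + 1/2` gives `Γ(2s+2k+1)`; splitting off `k` factors down to `Γ(2s+k+1)`
produces the binomial. -/
lemma gammaQuot_of_generic (k : ℕ) (s : ℂ) (hs : ∀ n : ℤ, 2 * s ≠ (n : ℂ)) :
    gammaQuot (k + 1 : ℕ) s =
      Real.sqrt Real.pi * (4 : ℂ) ^ (-(s + k)) * kummerCoeff s k := by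
  have hk : (k.factorial : ℂ) ≠ 0 := by exact_mod_cast k.factorial_ne_zero
  have h1 : Complex.Gamma (s + k + 1) ≠ 0 := by
    refine Complex.Gamma_ne_zero fun m hm => hs (-(2 * m + 2 * k + 2)) ?_
    push_cast
    linear_combination 2 * hm
  have h2 : Complex.Gamma (2 * s + k + 1) ≠ 0 := by
    refine Complex.Gamma_ne_zero fun m hm => hs (-(m + k + 1)) ?_
    push_cast
    linear_combination hm
  have hdup := Complex.Gamma_mul_Gamma_add_half (s + k + 1 / 2)
  have hprod := Gamma_add_one_eq_prod_mul (2 * s + 2 * k) k fun i _ hi => hs (i - 2 * k) (by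
    push_cast
    linear_combination hi)
  rw [show s + k + 1 / 2 + 1 / 2 = s + k + 1 by ring,
    show 2 * (s + k + 1 / 2) = 2 * s + 2 * k + 1 by ring, hprod,
    show 2 * s + 2 * k + 1 - k = 2 * s + k + 1 by ring,
    show 1 - (2 * s + 2 * k + 1) = (2 : ℕ) * -(s + k) by push_cast; ring,
    Complex.cpow_nat_mul (2 : ℂ) 2] at hdup
  have e4 : ((2 : ℂ) ^ (-(s + k))) ^ 2 = 4 ^ (-(s + k)) := by
    rw [sq, show (4 : ℂ) = (2 : ℕ) * (2 : ℕ) by norm_num, Complex.natCast_mul_natCast_cpow]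
    norm_num
  rw [e4] at hdup
  rw [gammaQuot, kummerCoeff, genBinom]
  push_cast
  rw [Complex.Gamma_nat_eq_factorial, show (k : ℂ) + 1 + s - 1 / 2 = s + k + 1 / 2 by ring,
    show (k : ℂ) + 1 + 2 * s = 2 * s + k + 1 by ring]
  generalize Complex.Gamma (s + k + 1 / 2) = A at hdup ⊢
  generalize (∏ i ∈ Finset.range k, (2 * s + 2 * (k : ℂ) - i)) = B at hdup ⊢
  generalize (4 : ℂ) ^ (-(s + k)) = D at hdup ⊢
  generalize Complex.Gamma (2 * s + k + 1) = E at hdup h2 ⊢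
  field_simp
  linear_combination hdup

lemma gammaQuot_tendsto_kummer (k : ℕ) (μ : ℂ) :
    Filter.Tendsto (fun s : ℂ => gammaQuot (k + 1 : ℕ) s) (𝓝[≠] μ)
      (𝓝 (Real.sqrt Real.pi * (4 : ℂ) ^ (-(μ + k)) * kummerCoeff μ k)) := by
  have hc : Continuous fun s : ℂ =>
      Real.sqrt Real.pi * (4 : ℂ) ^ (-(s + k)) * kummerCoeff s k := by
    refine (continuous_const.mul ?_).mul (continuous_kummerCoeff k)
    exact Continuous.const_cpow (by fun_prop) (Or.inl (by norm_num))
  refine (hc.continuousAt.mono_left nhdsWithin_le_nhds).congr' ?_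
  filter_upwards [eventually_two_mul_ne_int μ] with s hs
  exact (gammaQuot_of_generic k s hs).symm

lemma sumCoeff_eq_kummer (k : ℕ) (μ : ℂ) :
    sumCoeff (k + 1 : ℕ) μ = Real.sqrt Real.pi * (4 : ℂ) ^ (-(μ + k)) * kummerCoeff μ k := by
  rw [sumCoeff]
  split_ifs with h
  · exact (gammaQuot_tendsto_kummer k μ).limUnder_eq
  -- Away from the poles of the numerator the quotient is continuous, `1/Γ` being entire, so its
  -- value is its limit.
  · refine tendsto_nhds_unique ?_ (gammaQuot_tendsto_kummer k μ)
    have hc : ContinuousAt (fun s : ℂ => gammaQuot (k + 1 : ℕ) s) μ := by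
      unfold gammaQuot
      simp only [div_eq_mul_inv, mul_inv]
      refine ContinuousAt.mul ?_ (continuousAt_const.mul
        (continuous_inv_Gamma_comp (by fun_prop)).continuousAt)
      refine ContinuousAt.comp' (g := Complex.Gamma) ?_ (by fun_prop)
      refine (Complex.differentiableAt_Gamma _ fun m hm => h ⟨m, ?_⟩).continuousAt
      rw [← hm]
      ring
    exact hc.tendsto.mono_left nhdsWithin_le_nhds

lemma gammaQuot_tendsto_sumCoeff (k : ℕ) (μ : ℂ) :
    Filter.Tendsto (fun s : ℂ => gammaQuot (k + 1 : ℕ) s) (𝓝[≠] μ)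
      (𝓝 (sumCoeff (k + 1 : ℕ) μ)) := by
  rw [sumCoeff_eq_kummer]
  exact gammaQuot_tendsto_kummer k μ

/-! ### Powers of `1 + cos θ` and `1 + e^{iθ}` -/

lemma mul_ofReal_cpow (z s : ℂ) {t : ℝ} (ht : 0 < t) : (z * t) ^ s = z ^ s * (t : ℂ) ^ s := by
  have ht' : (t : ℂ) ≠ 0 := by exact_mod_cast ht.ne'
  rcases eq_or_ne z 0 with rfl | hz
  · rcases eq_or_ne s 0 with rfl | hs
    · simp
    · simp [Complex.zero_cpow hs]
  · rw [mul_comm z, Complex.cpow_def_of_ne_zero (mul_ne_zero ht' hz),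
      Complex.cpow_def_of_ne_zero hz, Complex.cpow_def_of_ne_zero ht', ← Complex.exp_add,
      Complex.log_ofReal_mul ht hz, Complex.ofReal_log ht.le]
    ring_nf

lemma one_add_cos_pos {θ : ℝ} (h : θ ∈ Set.Ioo (-Real.pi) Real.pi) : 0 < 1 + Real.cos θ := by
  have h1 : 0 < Real.cos (θ / 2) := Real.cos_pos_of_mem_Ioo ⟨by linarith [h.1], by linarith [h.2]⟩
  have h2 := Real.cos_two_mul (θ / 2)
  rw [show 2 * (θ / 2) = θ by ring] at h2
  rw [h2]
  nlinarith

/-- Jordan's inequality in `1 + cos θ = 2 sin²((π-θ)/2)`. The quadratic lower bound at `π` gives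
integrability of `(1 + cos θ)^r` for `r > -1/2`. -/
lemma le_one_add_cos {θ : ℝ} (h0 : 0 ≤ θ) (h1 : θ ≤ Real.pi) :
    2 / Real.pi ^ 2 * (Real.pi - θ) ^ 2 ≤ 1 + Real.cos θ := by
  have hs := Real.mul_le_sin (x := (Real.pi - θ) / 2) (by linarith) (by linarith)
  have h2 := Real.cos_sq' ((Real.pi - θ) / 2)
  have h3 := Real.cos_two_mul ((Real.pi - θ) / 2)
  rw [show 2 * ((Real.pi - θ) / 2) = Real.pi - θ by ring, Real.cos_pi_sub] at h3
  have h4 : 0 ≤ 2 / Real.pi * ((Real.pi - θ) / 2) :=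
    mul_nonneg (by positivity) (by linarith)
  have h5 := pow_le_pow_left₀ h4 hs 2
  have h6 : 2 / Real.pi ^ 2 * (Real.pi - θ) ^ 2 = 2 * (2 / Real.pi * ((Real.pi - θ) / 2)) ^ 2 := by
    field_simp
  rw [h6]
  linarith

lemma intervalIntegrable_one_add_cos_rpow {r : ℝ} (hr : -(1 / 2) < r) :
    IntervalIntegrable (fun θ : ℝ => (1 + Real.cos θ) ^ r) MeasureTheory.volume 0 Real.pi := by
  rcases le_or_gt 0 r with h | h
  · exact (Continuous.rpow_const (by fun_prop) fun _ => Or.inr h).intervalIntegrable _ _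
  · have h1 : IntervalIntegrable (fun θ : ℝ => (Real.pi - θ) ^ (2 * r)) MeasureTheory.volume
        0 Real.pi := by
      have := (intervalIntegral.intervalIntegrable_rpow' (a := Real.pi) (b := 0) (r := 2 * r)
        (by linarith)).comp_sub_left Real.pi
      simpa using this
    refine (h1.const_mul ((2 / Real.pi ^ 2) ^ r)).mono_fun ?_ ?_
    · exact (Measurable.aestronglyMeasurable (by fun_prop))
    · rw [Set.uIoc_of_le Real.pi_pos.le, ← MeasureTheory.Measure.restrict_congr_set
        MeasureTheory.Ioo_ae_eq_Ioc]
      refine (MeasureTheory.ae_restrict_iff' measurableSet_Ioo).2 (Filter.Eventually.of_forall ?_)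
      intro θ hθ
      have hp : 0 < Real.pi - θ := sub_pos.2 hθ.2
      have hb := le_one_add_cos hθ.1.le hθ.2.le
      have hpos : 0 < 2 / Real.pi ^ 2 * (Real.pi - θ) ^ 2 := by positivity
      have := Real.rpow_le_rpow_of_nonpos hpos hb h.le
      beta_reduce
      rw [Real.norm_of_nonneg (Real.rpow_nonneg (hpos.le.trans hb) _), Real.norm_of_nonneg
        (by positivity)]
      refine this.trans_eq ?_
      rw [Real.mul_rpow (by positivity) (by positivity), ← Real.rpow_natCast (Real.pi - θ),
        ← Real.rpow_mul hp.le]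
      norm_num

lemma aestronglyMeasurable_one_add_cos_cpow (s : ℂ) (m : MeasureTheory.Measure ℝ) :
    MeasureTheory.AEStronglyMeasurable (fun θ : ℝ => ((1 + Real.cos θ : ℝ) : ℂ) ^ s) m :=
  Measurable.aestronglyMeasurable (by fun_prop)

lemma intervalIntegrable_one_add_cos_cpow {s : ℂ} (hs : -(1 / 2) < s.re) :
    IntervalIntegrable (fun θ : ℝ => ((1 + Real.cos θ : ℝ) : ℂ) ^ s) MeasureTheory.volume
      0 Real.pi := by
  refine (intervalIntegrable_one_add_cos_rpow hs).mono_fun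
    (aestronglyMeasurable_one_add_cos_cpow s _) ?_
  rw [Set.uIoc_of_le Real.pi_pos.le, ← MeasureTheory.Measure.restrict_congr_set
    MeasureTheory.Ioo_ae_eq_Ioc]
  refine (MeasureTheory.ae_restrict_iff' measurableSet_Ioo).2 (Filter.Eventually.of_forall ?_)
  intro θ hθ
  have h := one_add_cos_pos ⟨by linarith [hθ.1, Real.pi_pos], hθ.2⟩
  beta_reduce
  rw [Complex.norm_cpow_eq_rpow_re_of_pos h, Real.norm_of_nonneg (by positivity)]

lemma intervalIntegrable_one_add_cos_cpow_neg {s : ℂ} (hs : -(1 / 2) < s.re) :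
    IntervalIntegrable (fun θ : ℝ => ((1 + Real.cos θ : ℝ) : ℂ) ^ s) MeasureTheory.volume
      (-Real.pi) 0 := by
  have h := (IntervalIntegrable.iff_comp_neg (by simp)).1 (intervalIntegrable_one_add_cos_cpow hs)
  simpa using h.symm

lemma one_add_exp_eq (θ : ℝ) :
    1 + Complex.exp (θ * Complex.I) =
      (2 * Real.cos (θ / 2) : ℝ) * Complex.exp (θ / 2 * Complex.I) := by
  have h : Complex.exp (θ * Complex.I) = Complex.exp (θ / 2 * Complex.I) ^ 2 := by
    rw [← Complex.exp_nat_mul]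
    congr 1
    push_cast
    ring
  push_cast
  rw [Complex.cos, neg_mul, Complex.exp_neg, h]
  have := Complex.exp_ne_zero (θ / 2 * Complex.I)
  field_simp
  ring

lemma one_add_exp_mem_slitPlane {θ : ℝ} (h : θ ∈ Set.Ioo (-Real.pi) Real.pi) :
    1 + Complex.exp (θ * Complex.I) ∈ Complex.slitPlane := by
  refine Or.inl ?_
  rw [Complex.add_re, Complex.exp_ofReal_mul_I_re, Complex.one_re]
  exact one_add_cos_pos h

/-- `1 + e^{iθ}` has modulus `2 cos(θ/2)`, whose square is `2(1 + cos θ)`, and principal argument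
`θ/2`. -/
lemma one_add_exp_cpow {θ : ℝ} (h : θ ∈ Set.Ioo (-Real.pi) Real.pi) (s : ℂ) :
    (1 + Complex.exp (θ * Complex.I)) ^ (2 * s) =
      2 ^ s * ((1 + Real.cos θ : ℝ) : ℂ) ^ s * Complex.exp (s * θ * Complex.I) := by
  have hc : 0 < 2 * Real.cos (θ / 2) :=
    mul_pos two_pos (Real.cos_pos_of_mem_Ioo ⟨by linarith [h.1], by linarith [h.2]⟩)
  have h0 := Complex.slitPlane_ne_zero (one_add_exp_mem_slitPlane h)
  have hsq : 2 * (1 + Real.cos θ) = (2 * Real.cos (θ / 2)) * (2 * Real.cos (θ / 2)) := by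
    have h2 := Real.cos_two_mul (θ / 2)
    rw [show 2 * (θ / 2) = θ by ring] at h2
    rw [h2]
    ring
  have e1 : (2 : ℂ) ^ s * ((1 + Real.cos θ : ℝ) : ℂ) ^ s =
      ((2 * Real.cos (θ / 2) : ℝ) : ℂ) ^ s * ((2 * Real.cos (θ / 2) : ℝ) : ℂ) ^ s := by
    rw [← mul_ofReal_cpow _ _ (one_add_cos_pos h), ← mul_ofReal_cpow _ _ hc, ← Complex.ofReal_mul,
      ← hsq]
    push_cast
    rfl
  have hc' : ((2 * Real.cos (θ / 2) : ℝ) : ℂ) ≠ 0 := by exact_mod_cast hc.ne'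
  have hlog : Complex.log (Complex.exp (θ / 2 * Complex.I)) = θ / 2 * Complex.I := by
    refine Complex.log_exp ?_ ?_ <;> simp <;> linarith [h.1, h.2, Real.pi_pos]
  rw [e1, Complex.cpow_def_of_ne_zero h0, one_add_exp_eq,
    Complex.log_ofReal_mul hc (Complex.exp_ne_zero _), hlog, Complex.cpow_def_of_ne_zero hc',
    ← Complex.exp_add, ← Complex.exp_add, Complex.ofReal_log hc.le]
  ring_nf

/-! ### Cauchy's cosine integral -/

/-- `∫ (1 + e^{iθ})^p e^{-ikθ} dθ` over a full period. -/
def binomIntegral (p : ℂ) (k : ℤ) : ℂ :=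
  ∫ θ in (-Real.pi)..Real.pi,
    (1 + Complex.exp (θ * Complex.I)) ^ p * Complex.exp (-(k * θ * Complex.I))

lemma uIoo_neg_pi_pi : Set.uIoo (-Real.pi) Real.pi = Set.Ioo (-Real.pi) Real.pi :=
  Set.uIoo_of_le (by linarith [Real.pi_pos])

lemma intervalIntegrable_binom {p : ℂ} (hp : -1 < p.re) (k : ℤ) :
    IntervalIntegrable (fun θ : ℝ => (1 + Complex.exp (θ * Complex.I)) ^ p *
      Complex.exp (-(k * θ * Complex.I))) MeasureTheory.volume (-Real.pi) Real.pi := by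
  have hs : -(1 / 2) < (p / 2).re := by
    rw [show p / 2 = ((1 / 2 : ℝ) : ℂ) * p by push_cast; ring, Complex.re_ofReal_mul]
    linarith
  have h := ((intervalIntegrable_one_add_cos_cpow_neg hs).trans
    (intervalIntegrable_one_add_cos_cpow hs)).const_mul (2 ^ (p / 2))
  have h1 := h.mul_continuousOn
    (g := fun θ : ℝ => Complex.exp (p / 2 * θ * Complex.I)) (by fun_prop)
  refine IntervalIntegrable.mul_continuousOn (h1.congr_uIoo ?_) (by fun_prop)
  intro θ hθ
  rw [uIoo_neg_pi_pi] at hθ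
  have := one_add_exp_cpow hθ (p / 2)
  rw [show 2 * (p / 2) = p by ring] at this
  exact this.symm

lemma binomIntegral_succ {p : ℂ} (hp : -1 < p.re) (k : ℤ) :
    binomIntegral (p + 1) k = binomIntegral p k + binomIntegral p (k - 1) := by
  unfold binomIntegral
  rw [← intervalIntegral.integral_add (intervalIntegrable_binom hp k)
    (intervalIntegrable_binom hp (k - 1))]
  refine intervalIntegral.integral_congr_uIoo fun θ hθ => ?_
  rw [uIoo_neg_pi_pi] at hθ
  have h0 := Complex.slitPlane_ne_zero (one_add_exp_mem_slitPlane hθ)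
  rw [Complex.cpow_add _ _ h0, Complex.cpow_one,
    show (-(((k - 1 : ℤ) : ℂ) * θ * Complex.I)) = θ * Complex.I + -(k * θ * Complex.I) by
      push_cast; ring, Complex.exp_add]
  ring

/-- Integrate the derivative of `(1 + e^{iθ})^{p+1} e^{-ikθ}`; the boundary values vanish because
`Re(p + 1) > 0`. -/
lemma binomIntegral_recurrence {p : ℂ} (hp : -1 < p.re) (k : ℤ) :
    k * binomIntegral p k = (p + 1 - k) * binomIntegral p (k - 1) := by
  have hpi : -Real.pi ≤ Real.pi := by linarith [Real.pi_pos]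
  have hp1 : 0 < (p + 1).re := by simp; linarith
  set g : ℤ → ℝ → ℂ := fun k θ => (1 + Complex.exp (θ * Complex.I)) ^ p *
      Complex.exp (-(k * θ * Complex.I)) with hg
  have hint := intervalIntegral.integral_eq_sub_of_hasDerivAt_of_le (a := -Real.pi) (b := Real.pi)
    (f := fun θ : ℝ => (1 + Complex.exp (θ * Complex.I)) ^ (p + 1) *
      Complex.exp (-(k * θ * Complex.I)))
    (f' := fun θ => Complex.I * ((p + 1 - k) * g (k - 1) θ - k * g k θ)) hpi ?_ ?_ ?_
  · have hI : Complex.exp (Real.pi * Complex.I) = -1 := Complex.exp_pi_mul_I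
    have hI' : Complex.exp (((-Real.pi : ℝ) : ℂ) * Complex.I) = -1 := by
      push_cast
      rw [neg_mul, Complex.exp_neg, hI]
      norm_num
    have hne : p + 1 ≠ 0 := fun h => by simp [h] at hp1
    simp only [hI, hI', add_neg_cancel, Complex.zero_cpow hne, zero_mul, sub_zero] at hint
    rw [intervalIntegral.integral_const_mul, intervalIntegral.integral_sub
      ((intervalIntegrable_binom hp (k - 1)).const_mul _)
      ((intervalIntegrable_binom hp k).const_mul _), intervalIntegral.integral_const_mul,
      intervalIntegral.integral_const_mul] at hint
    have := (mul_eq_zero.1 hint).resolve_left Complex.I_ne_zero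
    exact (sub_eq_zero.1 this).symm
  · refine ContinuousOn.mul ?_ (by fun_prop)
    intro θ _
    have h1 : ContinuousAt (fun w : ℂ => w ^ (p + 1)) (1 + Complex.exp (θ * Complex.I)) := by
      refine Complex.continuousAt_cpow_const_of_re_pos (Or.inl ?_) hp1
      rw [Complex.add_re, Complex.exp_ofReal_mul_I_re, Complex.one_re]
      linarith [Real.neg_one_le_cos θ]
    exact (ContinuousAt.comp' (f := fun θ : ℝ => 1 + Complex.exp (θ * Complex.I)) h1
      (by fun_prop)).continuousWithinAt
  · intro θ hθ
    have h0 := Complex.slitPlane_ne_zero (one_add_exp_mem_slitPlane hθ)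
    have hexp : HasDerivAt (fun w : ℂ => 1 + Complex.exp (w * Complex.I))
        (Complex.exp (θ * Complex.I) * Complex.I) θ := by
      simpa using (((hasDerivAt_id (θ : ℂ)).mul_const Complex.I).cexp).const_add 1
    have h1 := hexp.cpow_const (c := p + 1) (one_add_exp_mem_slitPlane hθ)
    have h2 : HasDerivAt (fun w : ℂ => Complex.exp (-(k * w * Complex.I)))
        (Complex.exp (-(k * θ * Complex.I)) * -(k * Complex.I)) θ := by
      simpa using (((hasDerivAt_id (θ : ℂ)).const_mul (k : ℂ)).mul_const Complex.I).neg.cexp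
    have h3 := (h1.mul h2).comp_ofReal
    refine h3.congr_deriv ?_
    simp only [hg]
    rw [show (-(((k - 1 : ℤ) : ℂ) * θ * Complex.I)) = θ * Complex.I + -(k * θ * Complex.I) by
      push_cast; ring, Complex.exp_add, Complex.cpow_add _ _ h0, Complex.cpow_one,
      add_sub_cancel_right]
    ring
  · exact (((intervalIntegrable_binom hp (k - 1)).const_mul _).sub
      ((intervalIntegrable_binom hp k).const_mul _)).const_mul _

/-- Mean value property of `(1 + w)^p` on the unit disc; `Re p > 0` gives continuity up to `w = -1`.
-/
lemma binomIntegral_zero_of_re_pos {p : ℂ} (hp : 0 < p.re) : binomIntegral p 0 = 2 * Real.pi := by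
  have hd : DiffContOnCl ℂ (fun w : ℂ => (1 + w) ^ p) (Metric.ball 0 |1|) := by
    have hre : ∀ w : ℂ, -‖w‖ ≤ w.re := fun w => (abs_le.1 (Complex.abs_re_le_norm w)).1
    refine ⟨fun w hw => ?_, fun w hw => ?_⟩
    · have : ‖w‖ < 1 := by simpa using hw
      refine (DifferentiableAt.cpow_const (by fun_prop) (Or.inl ?_)).differentiableWithinAt
      simp only [Complex.add_re, Complex.one_re]
      linarith [hre w]
    · have : ‖w‖ ≤ 1 := by simpa using Metric.closure_ball_subset_closedBall hw
      have h1 : ContinuousAt (fun w : ℂ => w ^ p) (1 + w) := by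
        refine Complex.continuousAt_cpow_const_of_re_pos (Or.inl ?_) hp
        simp only [Complex.add_re, Complex.one_re]
        linarith [hre w]
      exact (ContinuousAt.comp' (f := fun w : ℂ => 1 + w) h1 (by fun_prop)).continuousWithinAt
  have h := hd.circleAverage
  rw [Real.circleAverage_eq_integral_add (-Real.pi), intervalIntegral.integral_comp_add_right
    (fun θ => (1 + circleMap 0 1 θ) ^ p)] at h
  simp only [circleMap, Complex.ofReal_one, one_mul, zero_add, add_zero, Complex.one_cpow,
    Complex.real_smul] at h
  rw [show 2 * Real.pi + -Real.pi = Real.pi by ring] at h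
  have h2 : ((2 * Real.pi : ℝ) : ℂ) ≠ 0 := by exact_mod_cast (by positivity : 2 * Real.pi ≠ 0)
  rw [Complex.ofReal_inv, inv_mul_eq_iff_eq_mul₀ h2] at h
  simp only [binomIntegral, Int.cast_zero, zero_mul, neg_zero, Complex.exp_zero, mul_one]
  rw [h]
  push_cast
  ring

/-- The recurrence at `k = 0` has left side zero, and descends from there since `p + 1 + k` never
vanishes. -/
lemma binomIntegral_negSucc {p : ℂ} (hp : -1 < p.re) (k : ℕ) : binomIntegral p (-(k + 1)) = 0 := by
  have hne : ∀ k : ℕ, p + 1 + k ≠ 0 := fun k h => by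
    have := congrArg Complex.re h
    simp only [Complex.add_re, Complex.one_re, Complex.natCast_re, Complex.zero_re] at this
    have : (0 : ℝ) ≤ k := k.cast_nonneg
    linarith
  induction k with
  | zero =>
    have h := binomIntegral_recurrence hp 0
    simp only [Int.cast_zero, zero_mul, sub_zero, zero_sub] at h
    have h0 := hne 0
    rw [Nat.cast_zero, add_zero] at h0
    simpa using (mul_eq_zero.1 h.symm).resolve_left h0
  | succ k ih =>
    have h := binomIntegral_recurrence hp (-(k + 1))
    rw [ih, mul_zero, show (-((k : ℤ) + 1) - 1) = -(((k + 1 : ℕ) : ℤ) + 1) by push_cast; ring] at h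
    refine (mul_eq_zero.1 h.symm).resolve_left ?_
    have := hne (k + 1)
    push_cast at this ⊢
    rwa [sub_neg_eq_add]

lemma binomIntegral_natCast {p : ℂ} (hp : -1 < p.re) (k : ℕ) :
    binomIntegral p k = 2 * Real.pi * genBinom p k := by
  induction k with
  | zero =>
    -- Pascal's rule reduces `-1 < Re p` to the mean value case `p + 1`, the other term being zero.
    have h := binomIntegral_succ hp 0
    have h1 := binomIntegral_negSucc hp 0
    rw [binomIntegral_zero_of_re_pos (by simp; linarith)] at h
    simp only [CharP.cast_eq_zero, zero_add, zero_sub] at h1 h ⊢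
    rw [h1, add_zero] at h
    rw [← h, genBinom_zero_right, mul_one]
  | succ k ih =>
    have h := binomIntegral_recurrence hp (k + 1 : ℕ)
    have h' : (k : ℂ) + 1 ≠ 0 := by exact_mod_cast k.succ_ne_zero
    have h1 := genBinom_succ p k
    rw [show (((k + 1 : ℕ) : ℤ) - 1) = k by push_cast; ring, ih] at h
    refine mul_left_cancel₀ h' ?_
    push_cast at h ⊢
    linear_combination h - 2 * Real.pi * h1

/-- Cauchy's cosine integral, in terms of a full period. -/
lemma integral_one_add_cos_cpow_mul_cos {s : ℂ} (hs : -(1 / 2) < s.re) (k : ℤ) :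
    2 ^ s * (2 * ∫ θ in (0 : ℝ)..Real.pi, ((1 + Real.cos θ : ℝ) : ℂ) ^ s *
      Complex.cos ((s - k) * θ)) = binomIntegral (2 * s) k := by
  have e : binomIntegral (2 * s) k = ∫ θ in (-Real.pi)..Real.pi,
      2 ^ s * (((1 + Real.cos θ : ℝ) : ℂ) ^ s * Complex.exp ((s - k) * θ * Complex.I)) := by
    refine intervalIntegral.integral_congr_uIoo fun θ hθ => ?_
    rw [uIoo_neg_pi_pi] at hθ
    rw [one_add_exp_cpow hθ, show (s - k) * θ * Complex.I =
      s * θ * Complex.I + -(k * θ * Complex.I) by ring, Complex.exp_add]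
    ring
  have i1 := (intervalIntegrable_one_add_cos_cpow hs).mul_continuousOn
    (g := fun θ : ℝ => Complex.exp ((s - k) * θ * Complex.I)) (by fun_prop)
  have i2 := (intervalIntegrable_one_add_cos_cpow_neg hs).mul_continuousOn
    (g := fun θ : ℝ => Complex.exp ((s - k) * θ * Complex.I)) (by fun_prop)
  have i3 := (intervalIntegrable_one_add_cos_cpow hs).mul_continuousOn
    (g := fun θ : ℝ => Complex.exp ((s - k) * (-θ : ℝ) * Complex.I)) (by fun_prop)
  -- The weight is even, so reflecting the left half pairs the exponentials into a cosine.
  have hneg := intervalIntegral.integral_comp_neg (a := 0) (b := Real.pi)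
    (fun θ : ℝ => ((1 + Real.cos θ : ℝ) : ℂ) ^ s * Complex.exp ((s - k) * θ * Complex.I))
  rw [neg_zero] at hneg
  simp only [Real.cos_neg] at hneg
  rw [e, intervalIntegral.integral_const_mul,
    ← intervalIntegral.integral_add_adjacent_intervals i2 i1, ← hneg,
    ← intervalIntegral.integral_add i3 i1, ← intervalIntegral.integral_const_mul]
  congr 1
  refine intervalIntegral.integral_congr fun θ _ => ?_
  simp only [Complex.cos]
  push_cast
  ring_nf

/-! ### Termwise integration -/

lemma neg_half_lt_re_fracPart (μ : ℂ) : -(1 / 2) < (fracPart μ).re := by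
  have h := Int.ceil_lt_add_one (μ.re - 1 / 2)
  simp only [fracPart, nearestInt, Complex.sub_re, Complex.intCast_re]
  linarith

/-- The `θ`-independent factor `e^{iz} e^{-iπa/2} z^a` of the integrand. -/
def integrandFactor (a z : ℂ) : ℂ :=
  Complex.exp (Complex.I * z) * (Complex.exp (-(Real.pi / 2 * a * Complex.I)) * z ^ a)

lemma repIntegrand_eq (μ z : ℂ) {θ : ℝ} (hθ : θ ∈ Set.Ioo (-Real.pi) Real.pi) :
    repIntegrand μ z θ = integrandFactor (fracPart μ) z *
      (((1 + Real.cos θ : ℝ) : ℂ) ^ fracPart μ * Complex.cos (μ * θ)) *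
      ∑' m : ℕ, (Complex.Gamma (fracPart μ + m + 1))⁻¹ *
        (-(Complex.I * z) * (1 + Real.cos θ : ℝ)) ^ m := by
  have ha : ∀ n : ℕ, n ≠ 0 → fracPart μ ≠ -n := fun n hn h => by
    have h1 := neg_half_lt_re_fracPart μ
    have h2 : (1 : ℝ) ≤ n := by exact_mod_cast Nat.one_le_iff_ne_zero.2 hn
    rw [h, Complex.neg_re, Complex.natCast_re] at h1
    linarith
  have ht := one_add_cos_pos hθ
  rw [repIntegrand, show (1 : ℂ) + (Real.cos θ : ℂ) = ((1 + Real.cos θ : ℝ) : ℂ) by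
    rw [Complex.ofReal_add, Complex.ofReal_one], regGammaP, rotPow, gammaStar_eq_exp_mul_tsum _ _ ha,
    integrandFactor]
  have e1 : Complex.I * -(Complex.I * z * (1 + Real.cos θ : ℝ)) = z * (1 + Real.cos θ : ℝ) := by
    linear_combination (-(z * ((1 + Real.cos θ : ℝ) : ℂ))) * Complex.I_mul_I
  have e2 : Complex.exp (Complex.I * z) = Complex.exp (-(Complex.I * z * Real.cos θ)) *
      Complex.exp (- -(Complex.I * z * (1 + Real.cos θ : ℝ))) := by
    rw [← Complex.exp_add]
    congr 1
    rw [Complex.ofReal_add, Complex.ofReal_one]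
    ring
  rw [e1, mul_ofReal_cpow _ _ ht, e2, neg_mul]
  ring

/-- The bound is uniform in `θ`: it serves both continuity of the series and dominated convergence.
-/
lemma norm_integrand_term_le (a z : ℂ) (m : ℕ) (θ : ℝ) :
    ‖(Complex.Gamma (a + m + 1))⁻¹ * (-(Complex.I * z) * (1 + Real.cos θ : ℝ)) ^ m‖ ≤
      ‖(Complex.Gamma (a + m + 1))⁻¹ * (2 * z) ^ m‖ := by
  have h0 : 0 ≤ 1 + Real.cos θ := by linarith [Real.neg_one_le_cos θ]
  have h : ‖-(Complex.I * z) * (1 + Real.cos θ : ℝ)‖ ≤ ‖2 * z‖ := by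
    rw [norm_mul, norm_neg, norm_mul, Complex.norm_I, one_mul, Complex.norm_real,
      Real.norm_of_nonneg h0, norm_mul, RCLike.norm_ofNat, mul_comm]
    gcongr
    linarith [Real.cos_le_one θ]
  rw [norm_mul, norm_mul, norm_pow, norm_pow]
  gcongr

lemma intervalIntegrable_integrand_base (μ : ℂ) :
    IntervalIntegrable (fun θ : ℝ => ((1 + Real.cos θ : ℝ) : ℂ) ^ fracPart μ * Complex.cos (μ * θ))
      MeasureTheory.volume 0 Real.pi :=
  (intervalIntegrable_one_add_cos_cpow (neg_half_lt_re_fracPart μ)).mul_continuousOn (by fun_prop)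

lemma mem_Ioo_neg_pi_pi {θ : ℝ} (hθ : θ ∈ Set.Ioo 0 Real.pi) :
    θ ∈ Set.Ioo (-Real.pi) Real.pi := ⟨by linarith [hθ.1, Real.pi_pos], hθ.2⟩

lemma intervalIntegrable_repIntegrand (μ z : ℂ) :
    IntervalIntegrable (repIntegrand μ z) MeasureTheory.volume 0 Real.pi := by
  have hc : Continuous fun θ : ℝ => ∑' m : ℕ, (Complex.Gamma (fracPart μ + m + 1))⁻¹ *
      (-(Complex.I * z) * (1 + Real.cos θ : ℝ)) ^ m :=
    continuous_tsum (fun m => by fun_prop) (summable_norm_inv_Gamma_mul_pow _ (2 * z))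
      fun m θ => norm_integrand_term_le _ z m θ
  refine ((((intervalIntegrable_integrand_base μ).const_mul
    (integrandFactor (fracPart μ) z)).mul_continuousOn hc.continuousOn)).congr_uIoo fun θ hθ => ?_
  rw [Set.uIoo_of_le Real.pi_pos.le] at hθ
  exact (repIntegrand_eq μ z (mem_Ioo_neg_pi_pi hθ)).symm

lemma integral_integrand_term (μ z : ℂ) (m : ℕ) :
    ∫ θ in (0 : ℝ)..Real.pi, integrandFactor (fracPart μ) z *
      (((1 + Real.cos θ : ℝ) : ℂ) ^ fracPart μ * Complex.cos (μ * θ)) *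
      ((Complex.Gamma (fracPart μ + m + 1))⁻¹ *
        (-(Complex.I * z) * (1 + Real.cos θ : ℝ)) ^ m) =
    integrandFactor (fracPart μ) z * ((Complex.Gamma (fracPart μ + m + 1))⁻¹ *
      (-(Complex.I * z)) ^ m) * (binomIntegral (2 * (fracPart μ + m)) (m - nearestInt μ.re) /
        (2 * 2 ^ (fracPart μ + m))) := by
  have hs : -(1 / 2) < (fracPart μ + m).re := by
    have h1 := neg_half_lt_re_fracPart μ
    have h2 : (0 : ℝ) ≤ m := m.cast_nonneg
    simp only [Complex.add_re, Complex.natCast_re]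
    linarith
  rw [← integral_one_add_cos_cpow_mul_cos hs]
  have h2 : (2 : ℂ) ^ (fracPart μ + m) ≠ 0 := by simp [Complex.cpow_eq_zero_iff]
  have e : ∀ I : ℂ, 2 ^ (fracPart μ + m) * (2 * I) / (2 * 2 ^ (fracPart μ + m)) = I := fun I => by
    field_simp
  rw [e, ← intervalIntegral.integral_const_mul]
  refine intervalIntegral.integral_congr_Ioo_of_le Real.pi_pos.le fun θ hθ => ?_
  have ht : ((1 + Real.cos θ : ℝ) : ℂ) ≠ 0 := by
    exact_mod_cast (one_add_cos_pos (mem_Ioo_neg_pi_pi hθ)).ne'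
  -- The frequency `s - k` of Cauchy's integral is `μ` for every `m`.
  have e2 : fracPart μ + m - ((m - nearestInt μ.re : ℤ) : ℂ) = μ := by
    simp only [fracPart]
    push_cast
    ring
  rw [e2, Complex.cpow_add _ _ ht, Complex.cpow_natCast, mul_pow]
  ring

lemma hasSum_integral_repIntegrand (μ z : ℂ) :
    HasSum (fun m : ℕ => integrandFactor (fracPart μ) z *
      ((Complex.Gamma (fracPart μ + m + 1))⁻¹ * (-(Complex.I * z)) ^ m) *
        (binomIntegral (2 * (fracPart μ + m)) (m - nearestInt μ.re) /
          (2 * 2 ^ (fracPart μ + m))))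
      (∫ θ in (0 : ℝ)..Real.pi, repIntegrand μ z θ) := by
  simp only [← integral_integrand_term]
  set G : ℝ → ℂ := fun θ => integrandFactor (fracPart μ) z *
      (((1 + Real.cos θ : ℝ) : ℂ) ^ fracPart μ * Complex.cos (μ * θ)) with hG
  have hGi : IntervalIntegrable G MeasureTheory.volume 0 Real.pi :=
    (intervalIntegrable_integrand_base μ).const_mul _
  have hsum := summable_norm_inv_Gamma_mul_pow (fracPart μ) (2 * z)
  refine intervalIntegral.hasSum_integral_of_dominated_convergence
    (fun m θ => ‖G θ‖ * ‖(Complex.Gamma (fracPart μ + m + 1))⁻¹ * (2 * z) ^ m‖) ?_ ?_ ?_ ?_ ?_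
  · intro m
    rw [Set.uIoc_of_le Real.pi_pos.le]
    exact hGi.1.aestronglyMeasurable.mul (Continuous.aestronglyMeasurable (by fun_prop))
  · refine fun m => Filter.Eventually.of_forall fun θ _ => ?_
    rw [norm_mul]
    exact mul_le_mul_of_nonneg_left (norm_integrand_term_le _ z m θ) (norm_nonneg _)
  · exact Filter.Eventually.of_forall fun θ _ => hsum.mul_left _
  · simp only [tsum_mul_left]
    exact hGi.norm.mul_const _
  · have hne : ∀ᵐ θ : ℝ ∂MeasureTheory.volume, θ ≠ Real.pi := by
      simp [MeasureTheory.ae_iff]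
    filter_upwards [hne] with θ h1 h2
    rw [Set.uIoc_of_le Real.pi_pos.le] at h2
    rw [repIntegrand_eq μ z (mem_Ioo_neg_pi_pi ⟨h2.1, lt_of_le_of_ne h2.2 h1⟩)]
    refine HasSum.mul_left _ (Summable.hasSum ?_)
    exact Summable.of_norm_bounded hsum fun m => norm_integrand_term_le _ z m θ

/-! ### Matching with the Kummer terms -/

lemma I_cpow_mul_exp (μ : ℂ) (n : ℤ) :
    Complex.I ^ μ * Complex.exp (-(Real.pi / 2 * (μ - n) * Complex.I)) = Complex.I ^ n := by
  rw [Complex.cpow_def_of_ne_zero Complex.I_ne_zero, Complex.log_I, ← Complex.exp_add,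
    show Real.pi / 2 * Complex.I * μ + -(Real.pi / 2 * (μ - n) * Complex.I) =
      n * (Real.pi / 2 * Complex.I) by ring, Complex.exp_int_mul, Complex.exp_pi_div_two_mul_I]

lemma cpow_eq_scaled (z s : ℂ) {c : ℝ} (hc : 0 < c) :
    z ^ s = (z / c) ^ s * (c : ℂ) ^ s := by
  have : (c : ℂ) ≠ 0 := by exact_mod_cast hc.ne'
  rw [← mul_ofReal_cpow _ _ hc, div_mul_cancel₀ _ this]

lemma representation_term (μ : ℂ) {z : ℂ} (hz : z ≠ 0) (m k : ℕ) (n : ℤ) (h : (m : ℤ) - n = k) :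
    Complex.I ^ μ / Real.pi * (integrandFactor (μ - n) z *
      ((Complex.Gamma (μ - n + m + 1))⁻¹ * (-(Complex.I * z)) ^ m) *
        (2 * Real.pi * genBinom (2 * (μ - n + m)) k / (2 * 2 ^ (μ - n + m)))) =
    Complex.exp (Complex.I * z) * (z / 2) ^ μ *
      (kummerCoeff μ k * (-(Complex.I * z / 2)) ^ k) := by
  have hpi : (Real.pi : ℂ) ≠ 0 := by exact_mod_cast Real.pi_ne_zero
  have hmk : μ - n + m = μ + k := by
    have : ((m : ℤ) : ℂ) - n = k := by exact_mod_cast congrArg (Int.cast : ℤ → ℂ) h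
    push_cast at this
    linear_combination this
  have hz2 : z / 2 ≠ 0 := div_ne_zero hz two_ne_zero
  have h2a : (2 : ℂ) ^ (μ - n) ≠ 0 := by simp [Complex.cpow_eq_zero_iff]
  have hx : -(Complex.I * z / 2) ≠ 0 := by simp [hz]
  have e1 : (2 : ℂ) ^ (μ - n + m) = 2 ^ (μ - n) * 2 ^ m := by
    rw [Complex.cpow_add _ _ two_ne_zero, Complex.cpow_natCast]
  have e2 : z ^ (μ - n) = (z / 2) ^ (μ - n) * 2 ^ (μ - n) := by
    simpa using cpow_eq_scaled z (μ - n) (c := 2) two_pos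
  have e3 : (z / 2) ^ μ = (z / 2) ^ (μ - n) * (z / 2) ^ n := by
    rw [← Complex.cpow_intCast, ← Complex.cpow_add _ _ hz2, sub_add_cancel]
  have e4 : (-(Complex.I * z)) ^ m = 2 ^ m * (-(Complex.I * z / 2)) ^ m := by
    rw [← mul_pow]
    ring
  -- Since `i · (-iz/2) = z/2`, trading `m = k + n` for `k` turns `i^n` into `(z/2)^n`.
  have e5 : Complex.I ^ n * (-(Complex.I * z / 2)) ^ m =
      (z / 2) ^ n * (-(Complex.I * z / 2)) ^ k := by
    rw [← zpow_natCast _ m, ← zpow_natCast _ k, ← h, zpow_sub₀ hx, ← mul_div_assoc,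
      eq_div_iff (zpow_ne_zero _ hx), mul_right_comm, ← mul_zpow]
    congr 2
    linear_combination (-(z / 2)) * Complex.I_mul_I
  have e6 := I_cpow_mul_exp μ n
  rw [kummerCoeff, integrandFactor, show 2 * μ + 2 * (k : ℂ) = 2 * (μ - n + m) by rw [hmk]; ring,
    ← hmk, e1, e2, e3, e4]
  have h2m : (2 : ℂ) ^ m ≠ 0 := pow_ne_zero _ two_ne_zero
  generalize (2 : ℂ) ^ (μ - n) = A at h2a ⊢
  generalize (z / 2) ^ (μ - n) = B
  generalize (2 : ℂ) ^ m = D at h2m ⊢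
  generalize genBinom (2 * (μ - n + m)) k = E
  generalize (Complex.Gamma (μ - n + m + 1))⁻¹ = F
  generalize Complex.exp (Complex.I * z) = H
  generalize Complex.I ^ μ = P at e6 ⊢
  generalize Complex.exp (-(Real.pi / 2 * (μ - n) * Complex.I)) = Q at e6 ⊢
  generalize (-(Complex.I * z / 2)) ^ m = R at e5 ⊢
  generalize (-(Complex.I * z / 2)) ^ k = S at e5 ⊢
  generalize (z / 2) ^ n = T at e5 ⊢
  generalize Complex.I ^ n = U at e5 e6 ⊢
  field_simp
  linear_combination B * E * F * H * (R * e6 + e5)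

lemma extra_term (μ : ℂ) {z : ℂ} (hz : z ≠ 0) (k : ℕ) :
    Complex.I ^ μ / Real.sqrt Real.pi * Complex.exp (Complex.I * z) *
      (sumCoeff (k + 1 : ℕ) μ * rotPow (-(2 * Complex.I * z)) (((k + 1 : ℕ) : ℤ) + μ - 1)) =
    Complex.exp (Complex.I * z) * (z / 2) ^ μ *
      (kummerCoeff μ k * (-(Complex.I * z / 2)) ^ k) := by
  have hpi : (Real.sqrt Real.pi : ℂ) ≠ 0 := by
    exact_mod_cast (Real.sqrt_pos.2 Real.pi_pos).ne'
  have hz2 : z / 2 ≠ 0 := div_ne_zero hz two_ne_zero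
  have h4 : (4 : ℂ) ^ (μ + k) ≠ 0 := by simp [Complex.cpow_eq_zero_iff]
  -- The power of `4` cancels the one in `sumCoeff_eq_kummer`.
  have e1 : (2 * z) ^ (μ + k) = (z / 2) ^ μ * (z / 2) ^ k * 4 ^ (μ + k) := by
    have h := cpow_eq_scaled (2 * z) (μ + k) (c := 4) (by norm_num)
    rw [show 2 * z / ((4 : ℝ) : ℂ) = z / 2 by push_cast; ring, Complex.cpow_add _ _ hz2,
      Complex.cpow_natCast] at h
    rw [h]
    norm_num
  have e2 := I_cpow_mul_exp μ (-k)
  have e3 : Complex.I ^ (-(k : ℤ)) = (-Complex.I) ^ k := by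
    rw [zpow_neg, zpow_natCast, ← inv_pow, Complex.inv_I]
  have e4 : (-(Complex.I * z / 2)) ^ k = (-Complex.I) ^ k * (z / 2) ^ k := by
    rw [← mul_pow]
    ring
  rw [sumCoeff_eq_kummer, rotPow, e4, show (((k + 1 : ℕ) : ℤ) : ℂ) + μ - 1 = μ + k by
    push_cast; ring, show Complex.I * -(2 * Complex.I * z) = 2 * z by
    linear_combination (-(2 * z)) * Complex.I_mul_I, e1, Complex.cpow_neg, ← e3, ← e2]
  push_cast
  rw [sub_neg_eq_add]
  field_simp

lemma besselJ_eq_kummer (μ z : ℂ) :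
    besselJ μ z = Complex.exp (Complex.I * z) * (z / 2) ^ μ *
      ∑' k : ℕ, kummerCoeff μ k * (-(Complex.I * z / 2)) ^ k := by
  have h := tsum_bessel_eq_exp_mul_tsum_kummer μ (Complex.I * z / 2)
  rw [show 2 * (Complex.I * z / 2) = Complex.I * z by ring] at h
  rw [besselJ, mul_comm (Complex.exp _), mul_assoc, ← h]
  congr 1
  refine tsum_congr fun k => ?_
  rw [show (Complex.I * z / 2) ^ (2 * k) = (-1) ^ k * (z / 2) ^ (2 * k) by
    rw [pow_mul, pow_mul, ← mul_pow, mul_div_assoc, mul_pow, Complex.I_sq]]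

lemma Icc_one_neg_nearestInt_eq_empty_iff (x : ℝ) :
    Finset.Icc (1 : ℤ) (-nearestInt x) = ∅ ↔ -(1 / 2 : ℝ) < x := by
  have h : -1 < nearestInt x ↔ ((-1 : ℤ) : ℝ) < x - 1 / 2 := Int.lt_ceil
  push_cast at h
  rw [Finset.Icc_eq_empty_iff]
  constructor
  · intro h1
    have := h.1 (by omega)
    linarith
  · intro h1
    have := h.2 (by linarith)
    omega

lemma sum_Icc_one_eq_sum_range (f : ℤ → ℂ) (n : ℕ) :
    ∑ j ∈ Finset.Icc (1 : ℤ) n, f j = ∑ k ∈ Finset.range n, f (k + 1 : ℕ) := by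
  symm
  refine Finset.sum_nbij (fun k : ℕ => ((k + 1 : ℕ) : ℤ)) ?_ ?_ ?_ fun _ _ => rfl
  · intro k hk
    have := Finset.mem_range.1 hk
    exact Finset.mem_Icc.2 ⟨by omega, by omega⟩
  · intro a _ b _ hab
    simpa using hab
  · intro j hj
    have := Finset.mem_Icc.1 (Finset.mem_coe.1 hj)
    exact ⟨(j - 1).toNat, Finset.mem_coe.2 (Finset.mem_range.2 (by omega)), by simp only; omega⟩

lemma besselJ_representation_of_ne_zero (μ : ℂ) {z : ℂ} (hz : z ≠ 0) :
    besselJ μ z =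
      Complex.I ^ μ / Real.pi * (∫ θ in (0 : ℝ)..Real.pi, repIntegrand μ z θ) +
      Complex.I ^ μ / Real.sqrt Real.pi * Complex.exp (Complex.I * z) *
        ∑ j ∈ Finset.Icc (1 : ℤ) (-nearestInt μ.re),
          sumCoeff j μ * rotPow (-(2 * Complex.I * z)) (j + μ - 1) := by
  have hI := (hasSum_integral_repIntegrand μ z).mul_left (Complex.I ^ μ / Real.pi)
  have hre : ∀ m : ℕ, -1 < (2 * (fracPart μ + m)).re := fun m => by
    have h1 := neg_half_lt_re_fracPart μ
    have h2 : (0 : ℝ) ≤ m := m.cast_nonneg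
    rw [show (2 : ℂ) = ((2 : ℝ) : ℂ) by push_cast; rfl, Complex.re_ofReal_mul, Complex.add_re,
      Complex.natCast_re]
    linarith
  have hterm : ∀ m k : ℕ, (m : ℤ) - nearestInt μ.re = k →
      Complex.I ^ μ / Real.pi * (integrandFactor (fracPart μ) z *
      ((Complex.Gamma (fracPart μ + m + 1))⁻¹ * (-(Complex.I * z)) ^ m) *
        (binomIntegral (2 * (fracPart μ + m)) (m - nearestInt μ.re) /
          (2 * 2 ^ (fracPart μ + m)))) =
      Complex.exp (Complex.I * z) * (z / 2) ^ μ *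
        (kummerCoeff μ k * (-(Complex.I * z / 2)) ^ k) := fun m k hmk => by
    rw [hmk, binomIntegral_natCast (hre m)]
    exact representation_term μ hz m k _ hmk
  have hsumm : Summable fun k : ℕ => Complex.exp (Complex.I * z) * (z / 2) ^ μ *
        (kummerCoeff μ k * (-(Complex.I * z / 2)) ^ k) :=
    (summable_norm_kummer μ _).of_norm.mul_left _
  rw [besselJ_eq_kummer, ← tsum_mul_left]
  rcases le_or_gt 0 (nearestInt μ.re) with hN | hN
  · obtain ⟨n, hn⟩ := Int.eq_ofNat_of_zero_le hN
    rw [Finset.Icc_eq_empty (by omega), Finset.sum_empty, mul_zero, add_zero]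
    refine HasSum.tsum_eq ?_
    -- The first `n` integrated terms have negative binomial index and vanish.
    rw [← hasSum_nat_add_iff' n, Finset.sum_eq_zero, sub_zero] at hI
    · exact hI.congr_fun fun k => (hterm (k + n) k (by push_cast; omega)).symm
    · intro m hm
      have hm' := Finset.mem_range.1 hm
      have e : (m : ℤ) - nearestInt μ.re = -(((n - m - 1 : ℕ) : ℤ) + 1) := by omega
      rw [e, binomIntegral_negSucc (hre m)]
      simp
  · obtain ⟨n, hn⟩ := Int.eq_ofNat_of_zero_le (neg_nonneg.2 hN.le)
    -- The integral supplies the Kummer terms from index `n` on, the finite sum the first `n`.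
    rw [hn, sum_Icc_one_eq_sum_range, Finset.mul_sum, ← hI.tsum_eq, add_comm,
      ← hsumm.sum_add_tsum_nat_add n]
    congr 1
    · exact Finset.sum_congr rfl fun k _ => (extra_term μ hz k).symm
    · exact tsum_congr fun m => (hterm m (m + n) (by push_cast; omega)).symm

/-! ### The point `z = 0` -/

lemma nearestInt_intCast (n : ℤ) : nearestInt n = n := by
  rw [nearestInt, Int.ceil_eq_iff]
  constructor <;> linarith

lemma besselJ_representation_zero (n : ℤ) :
    besselJ n 0 =
      Complex.I ^ (n : ℂ) / Real.pi * (∫ θ in (0 : ℝ)..Real.pi, repIntegrand n 0 θ) +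
      Complex.I ^ (n : ℂ) / Real.sqrt Real.pi * Complex.exp (Complex.I * 0) *
        ∑ j ∈ Finset.Icc (1 : ℤ) (-nearestInt (n : ℂ).re),
          sumCoeff j n * rotPow (-(2 * Complex.I * 0)) (j + n - 1) := by
  have hpi : (Real.pi : ℂ) ≠ 0 := by exact_mod_cast Real.pi_ne_zero
  have hN : nearestInt (n : ℂ).re = n := by rw [Complex.intCast_re, nearestInt_intCast]
  have ha : fracPart n = 0 := by rw [fracPart, hN, sub_self]
  have hg : gammaStar 0 0 = 1 := by
    rw [gammaStar_eq_exp_mul_tsum 0 0 fun k hk h => hk (by simpa using h.symm),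
      tsum_eq_single 0 fun m hm => by simp [hm]]
    simp
  have hint : ∀ θ : ℝ, repIntegrand n 0 θ = Complex.cos (n * θ) := fun θ => by
    simp [repIntegrand, ha, regGammaP, rotPow, hg]
  have hsum : ∑ j ∈ Finset.Icc (1 : ℤ) (-n),
      sumCoeff j n * rotPow (-(2 * Complex.I * 0)) (j + n - 1) = 0 := by
    refine Finset.sum_eq_zero fun j hj => ?_
    have hj' := Finset.mem_Icc.1 hj
    -- The exponent is at most `-1`, where `0 ^ s` is `0` by convention; this is harmless, as
    -- `sumCoeff` vanishes there too.
    have hne : (j : ℂ) + n - 1 ≠ 0 := by exact_mod_cast (by omega : j + n - 1 ≠ 0)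
    simp [rotPow, Complex.zero_cpow hne]
  rw [hN, hsum, mul_zero, add_zero]
  simp only [hint]
  rcases eq_or_ne n 0 with rfl | hn
  · rw [besselJ, tsum_eq_single 0 fun m hm => by simp [hm]]
    simp [hpi]
  · have hn' : (n : ℂ) ≠ 0 := by exact_mod_cast hn
    rw [integral_cos_mul_complex hn', Complex.sin_int_mul_pi, besselJ, zero_div,
      Complex.zero_cpow hn']
    simp

end

theorem theorem1 (μ z : ℂ) (hz : z ∈ Complex.slitPlane ∨ ∃ m : ℤ, μ = (m : ℂ)) :
    IntervalIntegrable (repIntegrand μ z) MeasureTheory.volume 0 Real.pi ∧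
    (∀ j ∈ Finset.Icc (1 : ℤ) (-nearestInt μ.re),
      Filter.Tendsto (fun s : ℂ => gammaQuot j s) (𝓝[≠] μ) (𝓝 (sumCoeff j μ))) ∧
    (Finset.Icc (1 : ℤ) (-nearestInt μ.re) = ∅ ↔ -(1 / 2 : ℝ) < μ.re) ∧
    besselJ μ z =
      Complex.I ^ μ / Real.pi * (∫ θ in (0 : ℝ)..Real.pi, repIntegrand μ z θ) +
      Complex.I ^ μ / Real.sqrt Real.pi * Complex.exp (Complex.I * z) *
        ∑ j ∈ Finset.Icc (1 : ℤ) (-nearestInt μ.re),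
          sumCoeff j μ * rotPow (-(2 * Complex.I * z)) (j + μ - 1) := by
  refine ⟨intervalIntegrable_repIntegrand μ z, fun j hj => ?_,
    Icc_one_neg_nearestInt_eq_empty_iff μ.re, ?_⟩
  · have hj' := Finset.mem_Icc.1 hj
    obtain ⟨k, rfl⟩ : ∃ k : ℕ, j = ((k + 1 : ℕ) : ℤ) := ⟨(j - 1).toNat, by omega⟩
    exact gammaQuot_tendsto_sumCoeff k μ
  · rcases eq_or_ne z 0 with rfl | h0
    · obtain ⟨n, rfl⟩ := hz.resolve_left (by simp)
      exact besselJ_representation_zero n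
    · exact besselJ_representation_of_ne_zero μ h0
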